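/- Let $W$ be a real-valued random variable with expectation $\mu$ and variance $\sigma^2$, where $0<\sigma<\infty$. Let $K\ge 2$ and $\ell\ge 2$ be integers. Let $G_1,G_2,\ldots$ be undirected graphs with vertex sets $V(G_m)$ and finite edge sets $E(G_m)$, where each edge is an abstract object to which two endpoints are assigned, and an edge belonging to both $E(G_m)$ and $E(G_{m'})$ has the same endpoints in both graphs. Put $n_m:=|E(G_m)|$, $\mathcal V:=\bigcup_m V(G_m)$ and $\mathcal E:=\bigcup_m E(G_m)$, and assume $n_m\to\infty$ as $m\to\infty$. Let $M_i$, $i\in\mathcal V$, be mutually independent random variables, each uniformly distributed on an $\ell$-element set. For $k\in\mathcal E$ with endpoints $i$ and $j$ let $D_k:=1$ if $M_i=M_j$ and $D_k:=0$ otherwise, and let \[ \xi^*_m:=\frac{\sum_{k\in E(G_m)}D_k-n_m\ell^{-1}}{\sqrt{n_m\ell^{-1}(1-\ell^{-1})}}\,. \] Suppose that every $G_m$ has girth at least $K+1$ (that is, it has no cycle of length $K$ or less, a loop being a cycle of length $1$ and a pair of parallel edges a cycle of length $2$), and that $\xi^*_m$ converges in law, as $m\to\infty$, to a probability distribution which is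 not normal. Here point masses count as (degenerate) normal distributions. Then there exist random variables $X_k$, $k\in\mathcal E$, on a common probability space such that: \begin{itemize} \item for each $k\in\mathcal E$, $X_k$ has the same distribution as $W$; \item for each $m$, the family $X_k$, $k\in E(G_m)$, is $K$-tuplewise independent, that is, $X_{k_1},\ldots,X_{k_K}$ are mutually independent for any distinct $k_1,\ldots,k_K\in E(G_m)$; \item the standardized sums \[ S^*_m:=\frac{\sum_{k\in E(G_m)}X_k-n_m\mu}{\sigma\sqrt{n_m}} \] converge in law, as $m\to\infty$, to a probability distribution which is not normal. \end{itemize} (For the at most finitely many $m$ with $n_m=0$, the values of $\xi^*_m$ and $S^*_m$ are irrelevant.) -/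

import Mathlib

open MeasureTheory ProbabilityTheory Filter
open scoped Graph

/-- `G` has a cycle of length `L`: `L ≥ 1` distinct vertices `v 0, …, v (L - 1)` and `L` distinct
edges `e 0, …, e (L - 1)`, where `e i` joins `v i` and `v (i + 1)`, and `v L = v 0`.
A loop is a cycle of length `1`, and two parallel edges form a cycle of length `2`. -/
def HasCycleOfLength {V E : Type*} (G : Graph V E) (L : ℕ) : Prop :=
  1 ≤ L ∧ ∃ (v : ℕ → V) (e : ℕ → E), Set.InjOn v (Set.Iio L) ∧ Set.InjOn e (Set.Iio L) ∧
    v L = v 0 ∧ ∀ i < L, G.IsLink (e i) (v i) (v (i + 1))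

/-- The girth of a multigraph: the length of its shortest cycle, or `⊤` if there is no cycle. -/
noncomputable def graphGirth {V E : Type*} (G : Graph V E) : ℕ∞ :=
  ⨅ (L : ℕ) (_ : HasCycleOfLength G L), (L : ℕ∞)

/-- A family of random variables is `K`-tuplewise independent if any `K` of its members with
distinct indices are mutually independent. -/
def TuplewiseIndep {Ω ι : Type*} [MeasurableSpace Ω] (K : ℕ) (X : ι → Ω → ℝ) (P : Measure Ω) :
    Prop :=
  ∀ t : Fin K → ι, Function.Injective t → iIndepFun (fun j => X (t j)) P

open Classical in
/-- `D_k = 1` if the two endpoints of the edge `k` carry the same label, and `D_k = 0` otherwise. -/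
noncomputable def edgeMatch {Ω V E : Type*} {l : ℕ} (G : Graph V E) (M : V → Ω → Fin l) (k : E)
    (ω : Ω) : ℝ :=
  if ∃ i j, G.IsLink k i j ∧ M i ω = M j ω then 1 else 0

/-- `ξ* = (∑_{k ∈ E(G)} D_k - n l⁻¹) / √(n l⁻¹ (1 - l⁻¹))`, where `n` is the number of edges. -/
noncomputable def xiStar {Ω V E : Type*} {l : ℕ} (G : Graph V E) (M : V → Ω → Fin l) (ω : Ω) : ℝ :=
  ((∑ᶠ k ∈ E(G), edgeMatch G M k ω) - (E(G).ncard : ℝ) * (l : ℝ)⁻¹) /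
    √((E(G).ncard : ℝ) * (l : ℝ)⁻¹ * (1 - (l : ℝ)⁻¹))

/-- `S* = (∑_{k ∈ E(G)} X_k - n μ) / (σ √n)`, where `n` is the number of edges. -/
noncomputable def stdRowSum {Ω V E : Type*} (G : Graph V E) (X : E → Ω → ℝ) (μ σ : ℝ) (ω : Ω) : ℝ :=
  ((∑ᶠ k ∈ E(G), X k ω) - (E(G).ncard : ℝ) * μ) / (σ * √(E(G).ncard : ℝ))

/-- Normal distributions on the line, the point masses (variance `0`) included. -/
def IsNormalLaw (ν : Measure ℝ) : Prop :=
  ∃ (a : ℝ) (v : NNReal), ν = gaussianReal a v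

/-! Put `p = 1/l`. At most `K` edges of a graph of girth at least `K + 1` form a forest. Stripping a
leaf multiplies the probability that all edges match by `1/l`, because the label of the leaf is
uniform and independent of the other labels. So any `K` of the match indicators `D_k` are
independent, although their standardized sum has a non-normal limit.

This dependence is planted in variables with the law of `W`. Since `W` is not constant, its law is a
mixture, with weights `p` and `1 - p`, of two laws with means `μ + c (1 - p)` and `μ - c p`, where
`c ≠ 0` (`exists_centered_mixture`). Draw `X_k` from the first law if `D_k = 1` and from the second
otherwise, with fresh randomness at each edge: `X_k = μ + c (D_k - p) + noise`, the noise being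
centred given the labels. Averaging over `D_k` gives the law of `W`, and `K`-tuplewise independence
is inherited (`map_mixVar`, `iIndepFun_mixVar`).

Then `S* = r ξ* + (noise sum) / (σ √n)` with `r = c √(p (1 - p)) / σ ≠ 0`. Given the labels, the
noise sum is nearly normal, and its variance depends only on the proportion of matching edges, which
tends to `p` by pairwise independence. In the limit the noise is therefore normal and independent of
the labels (`tendsto_charFun_sum_mixVar`). If the convolution of the scaled limit of `ξ*` with this
normal law were normal, dividing characteristic functions would make the limit of `ξ*` normal
(`IsNormalLaw.of_conv_gaussianReal`). -/

/-! ### Large girth: small edge sets are forests and have leaves. -/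

section Forest

variable {V E : Type*} {G : Graph V E}

/-- A walk that never repeats an edge immediately and returns to a vertex contains a cycle. -/
theorem exists_hasCycleOfLength_of_walk {T : Finset E} {v : ℕ → V} {e : ℕ → E}
    (heT : ∀ i, e i ∈ T) (hlink : ∀ i, G.IsLink (e i) (v i) (v (i + 1)))
    (hne : ∀ i, e i ≠ e (i + 1)) (hrep : ∃ L, 1 ≤ L ∧ ∃ i, v (i + L) = v i) :
    ∃ L ≤ T.card, HasCycleOfLength G L := by
  classical
  obtain ⟨hL1, i, hi⟩ := Nat.find_spec hrep
  have hmin : ∀ m < Nat.find hrep, 1 ≤ m → ∀ j, v (j + m) ≠ v j := fun m hm h1 j hj ↦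
    Nat.find_min hrep hm ⟨h1, j, hj⟩
  set L := Nat.find hrep
  -- `L` is the least return time over all starting indices, so any `L` consecutive vertices of the
  -- walk are distinct.
  have hv : ∀ a b, a < b → b < a + L → v a ≠ v b := by
    intro a b hab hb h
    have := hmin (b - a) (by omega) (by omega) a
    rw [show a + (b - a) = b by omega] at this
    exact this h.symm
  have he : ∀ a b, a < b → b < a + L → e a ≠ e b := by
    intro a b hab hb h
    have h2 := hlink b
    rw [← h] at h2
    -- The repeated edge is traversed in the same direction, or in the opposite one; the latter is
    -- an immediate repetition or an early return to `v (a + 1)`.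
    rcases (hlink a).eq_and_eq_or_eq_and_eq h2 with ⟨h3, -⟩ | ⟨-, h4⟩
    · exact hv a b hab hb h3
    · by_cases hb' : b = a + 1
      · exact hne a (hb' ▸ h)
      · exact hv (a + 1) b (by omega) (by omega) h4
  have hinj : Set.InjOn (fun j ↦ e (i + j)) (Set.Iio L) := by
    intro a ha b hb hab
    simp only [Set.mem_Iio] at ha hb
    by_contra hne'
    rcases lt_or_gt_of_ne hne' with h | h
    · exact he (i + a) (i + b) (by omega) (by omega) hab
    · exact he (i + b) (i + a) (by omega) (by omega) hab.symm
  refine ⟨L, ?_, hL1, fun j ↦ v (i + j), fun j ↦ e (i + j), ?_, hinj, hi, fun j _ ↦ hlink (i + j)⟩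
  · have := Finset.card_le_card_of_injOn (s := Finset.range L) (t := T) (fun j ↦ e (i + j))
      (fun j _ ↦ heT _) (by simpa using hinj)
    simpa using this
  · intro a ha b hb hab
    simp only [Set.mem_Iio] at ha hb
    by_contra hne'
    rcases lt_or_gt_of_ne hne' with h | h
    · exact hv (i + a) (i + b) (by omega) (by omega) hab
    · exact hv (i + b) (i + a) (by omega) (by omega) hab.symm

/-- A nonempty set of edges, too small to contain a cycle, has a leaf. -/
theorem exists_leaf_of_le_graphGirth {K : ℕ} (hgirth : ((K + 1 : ℕ) : ℕ∞) ≤ graphGirth G)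
    {T : Finset E} (hT : ∀ e ∈ T, e ∈ E(G)) (hcard : T.card ≤ K) (hne : T.Nonempty) :
    ∃ e ∈ T, ∃ v w, G.IsLink e v w ∧ v ≠ w ∧ ∀ e' ∈ T, e' ≠ e → ¬ G.Inc e' v := by
  classical
  have hno : ∀ L ≤ T.card, ¬ HasCycleOfLength G L := by
    intro L hL hc
    have h1 : ((K + 1 : ℕ) : ℕ∞) ≤ (L : ℕ∞) := hgirth.trans (iInf₂_le L hc)
    have : K + 1 ≤ L := by exact_mod_cast h1
    omega
  have hloop : ∀ e ∈ T, ∀ v, ¬ G.IsLink e v v := by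
    intro e he v h
    refine hno 1 (Finset.card_pos.2 hne) ⟨le_rfl, fun _ ↦ v, fun _ ↦ e, ?_, ?_, rfl, fun _ _ ↦ h⟩
    all_goals
      intro a ha b hb _
      simp only [Set.mem_Iio] at ha hb
      omega
  -- Without a leaf, every oriented edge of `T` can be continued by a different edge of `T`, which
  -- yields an infinite walk.
  by_contra! hcon
  have hstep : ∀ e ∈ T, ∀ v w, G.IsLink e v w →
      ∃ e' ∈ T, e' ≠ e ∧ ∃ w', G.IsLink e' w w' := by
    intro e he v w h
    have hwv : w ≠ v := by
      rintro rfl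
      exact hloop e he _ h
    obtain ⟨e', he', hee', w', hw'⟩ := hcon e he w v h.symm hwv
    exact ⟨e', he', hee', w', hw'⟩
  let S := {x : E × V × V // x.1 ∈ T ∧ G.IsLink x.1 x.2.1 x.2.2}
  have hnext : ∀ x : S, ∃ y : S, y.1.1 ≠ x.1.1 ∧ y.1.2.1 = x.1.2.2 := by
    rintro ⟨⟨e, v, w⟩, he, h⟩
    obtain ⟨e', he', hee', w', hw'⟩ := hstep e he v w h
    exact ⟨⟨⟨e', w, w'⟩, he', hw'⟩, hee', rfl⟩
  choose next hnext1 hnext2 using hnext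
  obtain ⟨e₀, he₀⟩ := hne
  obtain ⟨v₀, w₀, h₀⟩ := Graph.exists_isLink_of_mem_edgeSet (hT e₀ he₀)
  let x : ℕ → S := fun n ↦ Nat.rec ⟨⟨e₀, v₀, w₀⟩, he₀, h₀⟩ (fun _ y ↦ next y) n
  have hx : ∀ n, x (n + 1) = next (x n) := fun n ↦ rfl
  have hvw : ∀ n, (x (n + 1)).1.2.1 = (x n).1.2.2 := fun n ↦ by rw [hx, hnext2]
  obtain ⟨a, b, hab, hv⟩ : ∃ a b, a < b ∧ (x b).1.2.1 = (x a).1.2.1 := by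
    -- The graph may have infinitely many vertices, but the walk only visits endpoints of edges in
    -- `T`.
    have hfin : (⋃ e ∈ T, {u | G.Inc e u}).Finite := by
      refine T.finite_toSet.biUnion fun e he ↦ ?_
      obtain ⟨u, w, h⟩ := Graph.exists_isLink_of_mem_edgeSet (hT e he)
      exact (Set.toFinite {u, w}).subset fun z hz ↦ hz.eq_or_eq_of_isLink h
    obtain ⟨a, -, b, -, hab, h⟩ := Set.infinite_univ.exists_lt_map_eq_of_mapsTo
      (f := fun n : ℕ ↦ (x n).1.2.1) (t := ⋃ e ∈ T, {u | G.Inc e u})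
      (fun n _ ↦ Set.mem_biUnion (x n).2.1 (x n).2.2.inc_left) hfin
    exact ⟨a, b, hab, h.symm⟩
  obtain ⟨L, hL, hc⟩ := exists_hasCycleOfLength_of_walk (G := G) (T := T)
    (v := fun n ↦ (x n).1.2.1) (e := fun n ↦ (x n).1.1) (fun n ↦ (x n).2.1)
    (fun n ↦ by
      have := (x n).2.2
      rwa [← hvw n] at this)
    (fun n ↦ by
      rw [hx]
      exact (hnext1 _).symm)
    ⟨b - a, by omega, a, by rw [show a + (b - a) = b by omega]; exact hv⟩
  exact hno L hL hc

end Forest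

/-! ### Independence of the match events of few edges. -/

section Labels

variable {V E Ω : Type*} {mΩ : MeasurableSpace Ω} {l : ℕ}

/-- The event that the two endpoints of the edge `k` carry the same label. -/
def matchSet (G : Graph V E) (M : V → Ω → Fin l) (k : E) : Set Ω :=
  {ω | ∃ i j, G.IsLink k i j ∧ M i ω = M j ω}

theorem matchSet_eq_of_isLink {G : Graph V E} (M : V → Ω → Fin l) {k : E} {i j : V}
    (h : G.IsLink k i j) : matchSet G M k = {ω | M i ω = M j ω} := by
  ext ω
  refine ⟨?_, fun hω ↦ ⟨i, j, h, hω⟩⟩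
  rintro ⟨i', j', h', hω⟩
  rcases h.eq_and_eq_or_eq_and_eq h' with ⟨rfl, rfl⟩ | ⟨rfl, rfl⟩
  · exact hω
  · exact hω.symm

theorem measurableSet_matchSet {G : Graph V E} {M : V → Ω → Fin l}
    (hM : ∀ i ∈ V(G), Measurable (M i)) {k : E} (hk : k ∈ E(G)) :
    MeasurableSet (matchSet G M k) := by
  obtain ⟨i, j, h⟩ := Graph.exists_isLink_of_mem_edgeSet hk
  rw [matchSet_eq_of_isLink M h]
  exact measurableSet_eq_fun (hM i h.left_mem) (hM j h.right_mem)

/-- Few enough edges of a graph of large girth match independently. -/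
theorem measure_biInter_matchSet {G : Graph V E} {M : V → Ω → Fin l} {P : Measure Ω}
    [IsProbabilityMeasure P] (hM : ∀ i ∈ V(G), Measurable (M i))
    (hunif : ∀ i ∈ V(G), ∀ c : Fin l, P {ω | M i ω = c} = (l : ENNReal)⁻¹)
    (hindep : iIndepFun (fun i : V(G) ↦ M i) P)
    {K : ℕ} (hgirth : ((K + 1 : ℕ) : ℕ∞) ≤ graphGirth G)
    (T : Finset E) (hT : ∀ e ∈ T, e ∈ E(G)) (hcard : T.card ≤ K) :
    P (⋂ k ∈ T, matchSet G M k) = (l : ENNReal)⁻¹ ^ T.card := by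
  classical
  induction hn : T.card generalizing T with
  | zero =>
    rw [Finset.card_eq_zero] at hn
    simp [hn]
  | succ n ih =>
    have hne : T.Nonempty := Finset.card_pos.1 (by omega)
    obtain ⟨e, he, v, w, hlink, hvw, hleaf⟩ := exists_leaf_of_le_graphGirth hgirth hT hcard hne
    have hcard' : (T.erase e).card = n := by rw [Finset.card_erase_of_mem he]; omega
    have ih' := ih (T.erase e) (fun k hk ↦ hT k (Finset.mem_of_mem_erase hk)) (by omega) hcard'
    set B := ⋂ k ∈ T.erase e, matchSet G M k with hB
    let v' : V(G) := ⟨v, hlink.left_mem⟩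
    let m : V(G) → MeasurableSpace Ω := fun i ↦ MeasurableSpace.comap (M i) inferInstance
    -- `m'` carries all labels except that of the leaf `v`. No other edge of `T` meets `v`, so `B`
    -- and the label of `w` are `m'`-measurable, hence independent of the label of `v`.
    let m' : MeasurableSpace Ω := ⨆ i ∈ ({v'}ᶜ : Set V(G)), m i
    have hind : Indep (⨆ i ∈ ({v'} : Set V(G)), m i) m' P :=
      indep_iSup_of_disjoint (fun i : V(G) ↦ (hM i i.2).comap_le) hindep.iIndep disjoint_compl_right
    have hmeas : ∀ i ∈ V(G), i ≠ v → ∀ c, MeasurableSet[m'] {ω | M i ω = c} := by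
      intro i hi hiv c
      have hle : m ⟨i, hi⟩ ≤ m' := le_iSup₂_of_le (f := fun i (_ : i ∈ ({v'}ᶜ : Set V(G))) ↦ m i)
        ⟨i, hi⟩ (by simpa [v'] using hiv) le_rfl
      exact hle _ ⟨{c}, measurableSet_singleton c, rfl⟩
    have hBm : MeasurableSet[m'] B := by
      refine Finset.measurableSet_biInter _ fun k hk ↦ ?_
      obtain ⟨hke, hkT⟩ := Finset.mem_erase.1 hk
      obtain ⟨i, j, h⟩ := Graph.exists_isLink_of_mem_edgeSet (hT k hkT)
      have hnv := hleaf k hkT hke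
      have hi : i ≠ v := fun hiv ↦ hnv (hiv ▸ h.inc_left)
      have hj : j ≠ v := fun hjv ↦ hnv (hjv ▸ h.inc_right)
      have heq : matchSet G M k = ⋃ c, {ω | M i ω = c} ∩ {ω | M j ω = c} := by
        rw [matchSet_eq_of_isLink M h]
        ext ω
        simp [eq_comm]
      rw [heq]
      exact MeasurableSet.iUnion fun c ↦
        (hmeas i h.left_mem hi c).inter (hmeas j h.right_mem hj c)
    have hm' : m' ≤ mΩ := iSup₂_le fun i _ ↦ (hM i i.2).comap_le
    have hsplit : ⋂ k ∈ T, matchSet G M k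
        = ⋃ c, ({ω | M v ω = c} ∩ (B ∩ {ω | M w ω = c})) := by
      rw [← Finset.insert_erase he, Finset.set_biInter_insert, ← hB,
        matchSet_eq_of_isLink M hlink]
      ext ω
      simp [and_comm, eq_comm]
    have hw := hlink.right_mem
    have hterm : ∀ c, P ({ω | M v ω = c} ∩ (B ∩ {ω | M w ω = c}))
        = (l : ENNReal)⁻¹ * P (B ∩ {ω | M w ω = c}) := by
      intro c
      rw [← hunif v hlink.left_mem c]
      refine (Indep_iff _ _ _).1 hind _ _ ?_ (hBm.inter (hmeas w hw hvw.symm c))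
      have hle : m v' ≤ ⨆ i ∈ ({v'} : Set V(G)), m i :=
        le_iSup₂_of_le (f := fun i (_ : i ∈ ({v'} : Set V(G))) ↦ m i) v' rfl le_rfl
      exact hle _ ⟨{c}, measurableSet_singleton c, rfl⟩
    have hBsum : P B = ∑ c, P (B ∩ {ω | M w ω = c}) := by
      rw [← tsum_fintype (L := .unconditional _), ← measure_iUnion]
      · congr 1
        ext ω
        simp
      · intro c d hcd
        refine Set.disjoint_left.2 fun ω h1 h2 ↦ hcd ?_
        exact h1.2.symm.trans h2.2
      · exact fun c ↦ (hm' _ hBm).inter (hm' _ (hmeas w hw hvw.symm c))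
    rw [hsplit, measure_iUnion, tsum_fintype, Finset.sum_congr rfl fun c _ ↦ hterm c,
      ← Finset.mul_sum, ← hBsum, ih', pow_succ']
    · intro c d hcd
      refine Set.disjoint_left.2 fun ω h1 h2 ↦ hcd ?_
      exact h1.1.symm.trans h2.1
    · exact fun c ↦ (hM v hlink.left_mem (measurableSet_singleton c)).inter
        ((hm' _ hBm).inter (hm' _ (hmeas w hw hvw.symm c)))

/-- Any `K` edges of a graph of girth greater than `K` match independently. -/
theorem iIndepSet_matchSet {G : Graph V E} {M : V → Ω → Fin l} {P : Measure Ω}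
    [IsProbabilityMeasure P] (hM : ∀ i ∈ V(G), Measurable (M i))
    (hunif : ∀ i ∈ V(G), ∀ c : Fin l, P {ω | M i ω = c} = (l : ENNReal)⁻¹)
    (hindep : iIndepFun (fun i : V(G) ↦ M i) P)
    {K : ℕ} (hK : 1 ≤ K) (hgirth : ((K + 1 : ℕ) : ℕ∞) ≤ graphGirth G)
    {ι : Type*} [Fintype ι] (hι : Fintype.card ι ≤ K) (t : ι → E) (ht : Function.Injective t)
    (htG : ∀ j, t j ∈ E(G)) :
    iIndepSet (fun j ↦ matchSet G M (t j)) P := by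
  classical
  rw [iIndepSet_iff_meas_biInter fun j ↦ measurableSet_matchSet hM (htG j)]
  intro s
  have hone : ∀ j, P (matchSet G M (t j)) = (l : ENNReal)⁻¹ := fun j ↦ by
    simpa using measure_biInter_matchSet hM hunif hindep hgirth {t j}
      (by simpa using htG j) (by simpa using hK)
  have hs : s.card ≤ K := (Finset.card_le_univ s).trans hι
  have := measure_biInter_matchSet hM hunif hindep hgirth (s.image t)
    (by simp only [Finset.mem_image]; rintro e ⟨j, -, rfl⟩; exact htG j)
    (by rwa [Finset.card_image_of_injective _ ht])
  rw [Finset.card_image_of_injective _ ht, Finset.set_biInter_finset_image] at this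
  simpa [hone] using this

end Labels

/-! ### Mixtures, characteristic function estimates, and division by a normal factor. -/

section Probability

open Complex (I)
open scoped Topology

/-- Random variables built from two independent families, each of them independent, are
independent. -/
theorem iIndepFun_prod_of_iIndepFun {ι Ω₁ Ω₂ α β γ : Type*} [MeasurableSpace Ω₁]
    [MeasurableSpace Ω₂] [MeasurableSpace α] [MeasurableSpace β] [MeasurableSpace γ]
    {P : Measure Ω₁} {Q : Measure Ω₂} [IsProbabilityMeasure P] [IsProbabilityMeasure Q]
    {f : ι → Ω₁ → α} {g : ι → Ω₂ → β} (hf : ∀ i, Measurable (f i)) (hg : ∀ i, Measurable (g i))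
    (hfi : iIndepFun f P) (hgi : iIndepFun g Q) {F : α × β → γ} (hF : Measurable F) :
    iIndepFun (fun i z ↦ F (f i z.1, g i z.2)) (P.prod Q) := by
  classical
  rw [iIndepFun_iff_measure_inter_preimage_eq_mul]
  intro S B hB
  let B' : ι → Set γ := fun i ↦ if i ∈ S then B i else Set.univ
  have hB' : ∀ i, MeasurableSet (B' i) := by
    intro i
    by_cases h : i ∈ S
    · simpa [B', h] using hB i h
    · simp [B', h]
  have hBB : ∀ i ∈ S, B i = B' i := fun i h ↦ by simp [B', h]
  -- `h i a` is the conditional probability of the `i`-th event given `f i = a`. By Fubini,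
  -- independence of `g` makes the conditional probability of the intersection a product of such
  -- terms, and independence of `f` factors its integral.
  let h : ι → α → ENNReal := fun i a ↦ Q (Prod.mk a ⁻¹' {y : α × Ω₂ | F (y.1, g i y.2) ∈ B' i})
  have hm : ∀ i, Measurable (h i) := fun i ↦ by
    refine measurable_measure_prodMk_left
      (?_ : MeasurableSet {y : α × Ω₂ | F (y.1, g i y.2) ∈ B' i})
    exact (hF.comp (measurable_fst.prodMk ((hg i).comp measurable_snd))) (hB' i)
  have hset : ∀ i, MeasurableSet ((fun z : Ω₁ × Ω₂ ↦ F (f i z.1, g i z.2)) ⁻¹' B' i) := fun i ↦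
    (hF.comp (((hf i).comp measurable_fst).prodMk ((hg i).comp measurable_snd))) (hB' i)
  have hL : (P.prod Q) (⋂ i ∈ S, (fun z : Ω₁ × Ω₂ ↦ F (f i z.1, g i z.2)) ⁻¹' B' i)
      = ∫⁻ ω, ∏ i ∈ S, h i (f i ω) ∂P := by
    rw [Measure.prod_apply (Finset.measurableSet_biInter _ fun i _ ↦ hset i)]
    refine lintegral_congr fun ω ↦ ?_
    have := (iIndepFun_iff_measure_inter_preimage_eq_mul.1
      (hgi.comp (fun i b ↦ F (f i ω, b)) fun i ↦ hF.comp measurable_prodMk_left)) S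
      (sets := B') (fun i _ ↦ hB' i)
    rw [Set.preimage_iInter₂]
    exact this
  have hR : ∀ i, (P.prod Q) ((fun z : Ω₁ × Ω₂ ↦ F (f i z.1, g i z.2)) ⁻¹' B' i)
      = ∫⁻ ω, h i (f i ω) ∂P := fun i ↦ by
    rw [Measure.prod_apply (hset i)]
    rfl
  rw [Set.iInter₂_congr fun i hi ↦ by rw [hBB i hi],
    Finset.prod_congr rfl fun i hi ↦ by rw [hBB i hi], hL, Finset.prod_congr rfl fun i _ ↦ hR i]
  exact lintegral_prod_eq_prod_lintegral_of_indepFun S (fun i ω ↦ h i (f i ω))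
    (hfi.comp h hm) fun i ↦ (hm i).comp (hf i)

/-- The law with bounded density `f` with respect to `L`, centred at its mean. -/
theorem exists_centered_of_density {L : Measure ℝ} [IsProbabilityMeasure L] (h2 : MemLp id 2 L)
    {f : ℝ → ℝ} (hf : Measurable f) (hf0 : ∀ x, 0 ≤ f x) (hf2 : ∀ x, f x ≤ 2)
    (hint : ∫ x, f x ∂L = 1) :
    ∃ η : Measure ℝ, IsProbabilityMeasure η ∧ MemLp id 2 η ∧ ∫ x, x ∂η = 0 ∧
      η.map (fun x ↦ (∫ y, f y * y ∂L) + x) = L.withDensity fun x ↦ ENNReal.ofReal (f x) := by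
  set m := ∫ y, f y * y ∂L with hm
  set D := L.withDensity fun x ↦ ENNReal.ofReal (f x) with hD
  have hfi : Integrable f L := Integrable.of_bound hf.aestronglyMeasurable 2
    (ae_of_all _ fun x ↦ by rw [Real.norm_eq_abs, abs_of_nonneg (hf0 x)]; exact hf2 x)
  have : IsProbabilityMeasure D := ⟨by
    rw [hD, withDensity_apply _ MeasurableSet.univ, Measure.restrict_univ,
      ← ofReal_integral_eq_lintegral_ofReal hfi (ae_of_all _ hf0), hint, ENNReal.ofReal_one]⟩
  have hD2 : MemLp id 2 D := by
    refine h2.of_measure_le_smul (c := 2) (by simp) ?_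
    rw [hD, ← withDensity_const]
    refine withDensity_mono (ae_of_all _ fun x ↦ ?_)
    exact ENNReal.ofReal_le_of_le_toReal (by simpa using hf2 x)
  have hmean : ∫ x, x ∂D = m := by
    rw [hD, integral_withDensity_eq_integral_toReal_smul (by fun_prop) (by simp), hm]
    refine integral_congr_ae (ae_of_all _ fun x ↦ ?_)
    simp [ENNReal.toReal_ofReal (hf0 x)]
  have hDi : Integrable (fun x : ℝ ↦ x) D := hD2.integrable one_le_two
  refine ⟨D.map (fun x ↦ x - m), Measure.isProbabilityMeasure_map (by fun_prop), ?_, ?_, ?_⟩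
  · rw [memLp_map_measure_iff (by fun_prop) (by fun_prop)]
    exact hD2.sub (memLp_const m)
  · rw [integral_map (by fun_prop) (by fun_prop), integral_sub hDi (integrable_const _), hmean]
    simp
  · rw [Measure.map_map (by fun_prop) (by fun_prop)]
    convert Measure.map_id
    ext x
    simp

/-- A non-degenerate square integrable law is a mixture, with prescribed weights, of two square
integrable laws with different means. -/
theorem exists_centered_mixture {L : Measure ℝ} [IsProbabilityMeasure L] (h2 : MemLp id 2 L)
    {μ : ℝ} (hμ : ∫ x, x ∂L = μ) (hvar : variance id L ≠ 0) {p : ℝ} (hp0 : 0 ≤ p) (hp1 : p ≤ 1) :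
    ∃ (c : ℝ) (η₁ η₀ : Measure ℝ), c ≠ 0 ∧ IsProbabilityMeasure η₁ ∧ IsProbabilityMeasure η₀ ∧
      MemLp id 2 η₁ ∧ MemLp id 2 η₀ ∧ ∫ x, x ∂η₁ = 0 ∧ ∫ x, x ∂η₀ = 0 ∧
      ENNReal.ofReal p • η₁.map (fun x ↦ μ + c * (1 - p) + x) +
        ENNReal.ofReal (1 - p) • η₀.map (fun x ↦ μ + c * (0 - p) + x) = L := by
  have hid : Integrable (fun x : ℝ ↦ x) L := h2.integrable one_le_two
  set A : Set ℝ := Set.Ioi μ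
  have hA : MeasurableSet A := measurableSet_Ioi
  set q := L.real A with hq
  have hq0 : 0 ≤ q := measureReal_nonneg
  have hq1 : q ≤ 1 := measureReal_le_one
  -- Tilting `L` by `1 + b g` with `|b| ≤ 1` keeps a probability density, since `|g| ≤ 1` and `g`
  -- has mean zero, and shifts the mean by `c b`.
  set g : ℝ → ℝ := fun x ↦ A.indicator 1 x - q with hg
  have hgm : Measurable g := (measurable_one.indicator hA).sub_const q
  have hgabs : ∀ x, |g x| ≤ 1 := by
    intro x
    by_cases hx : x ∈ A
    · simp only [hg, Set.indicator_of_mem hx, Pi.one_apply, abs_le]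
      constructor <;> linarith
    · simp only [hg, Set.indicator_of_notMem hx, abs_le]
      constructor <;> linarith
  have hgi : Integrable g L := Integrable.of_bound hgm.aestronglyMeasurable 1
    (ae_of_all _ hgabs)
  have hg0 : ∫ x, g x ∂L = 0 := by
    have h1 : Integrable (A.indicator (1 : ℝ → ℝ)) L := (integrable_const (1 : ℝ)).indicator hA
    simp only [hg]
    rw [integral_sub h1 (integrable_const q), integral_indicator_one hA]
    simp [hq]
  have hgx : Integrable (fun x ↦ g x * x) L :=
    hid.bdd_mul hgm.aestronglyMeasurable (ae_of_all _ hgabs)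
  set c := ∫ x, g x * x ∂L with hc
  have hposi : Integrable (fun x ↦ A.indicator (fun x ↦ x - μ) x) L :=
    (hid.sub (integrable_const μ)).indicator hA
  -- As `g` has mean zero, `c` is the expectation of the positive part of `x - μ`; it vanishes only
  -- if the law is concentrated at `μ`.
  have hcpos : c = ∫ x, A.indicator (fun x ↦ x - μ) x ∂L := by
    have h1 : c = ∫ x, (g x * x - μ * g x) ∂L := by
      rw [integral_sub hgx (hgi.const_mul μ), integral_const_mul, hg0]
      simp [hc]
    have h2 : ∀ x, g x * x - μ * g x = A.indicator (fun x ↦ x - μ) x - q * (x - μ) := by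
      intro x
      by_cases hx : x ∈ A <;> simp [hg, hx] <;> ring
    rw [h1]
    simp_rw [h2]
    have h3 : Integrable (fun x ↦ q * (x - μ)) L := (hid.sub (integrable_const μ)).const_mul q
    rw [integral_sub hposi h3, integral_const_mul, integral_sub hid (integrable_const μ), hμ]
    simp
  have hc0 : c ≠ 0 := by
    intro h0
    have hnn : 0 ≤ fun x ↦ A.indicator (fun x ↦ x - μ) x := fun x ↦
      Set.indicator_nonneg (s := A) (fun y hy ↦ sub_nonneg.2 (le_of_lt hy)) x
    rw [hcpos, integral_eq_zero_iff_of_nonneg hnn hposi] at h0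
    have hle : 0 ≤ᵐ[L] fun x ↦ μ - x := by
      filter_upwards [h0] with x hx
      by_contra hlt
      have hxA : x ∈ A := by
        simp only [Pi.zero_apply, sub_nonneg, not_le] at hlt
        exact hlt
      rw [Set.indicator_of_mem hxA] at hx
      simp only [Pi.zero_apply] at hx hlt
      linarith
    have hint0 : ∫ x, (μ - x) ∂L = 0 := by
      rw [integral_sub (integrable_const μ) hid, hμ]
      simp
    rw [integral_eq_zero_iff_of_nonneg_ae hle ((integrable_const μ).sub hid)] at hint0
    refine hvar ?_
    have hae : (id : ℝ → ℝ) =ᵐ[L] fun _ ↦ μ := by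
      filter_upwards [hint0] with x hx
      simp only [Pi.zero_apply] at hx
      simp only [id]
      linarith
    rw [variance_congr hae, variance_eq_integral aemeasurable_const]
    simp
  have hdens : ∀ b : ℝ, |b| ≤ 1 → ∃ η : Measure ℝ, IsProbabilityMeasure η ∧ MemLp id 2 η ∧
      ∫ x, x ∂η = 0 ∧ η.map (fun x ↦ μ + c * b + x)
        = L.withDensity fun x ↦ ENNReal.ofReal (1 + b * g x) := by
    intro b hb
    have hbg : ∀ x, |b * g x| ≤ 1 := fun x ↦ by
      rw [abs_mul]
      exact mul_le_one₀ hb (abs_nonneg _) (hgabs x)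
    obtain ⟨η, h1, h2', h3, h4⟩ := exists_centered_of_density h2 (f := fun x ↦ 1 + b * g x)
      ((hgm.const_mul b).const_add 1) (fun x ↦ by linarith [(abs_le.1 (hbg x)).1])
      (fun x ↦ by linarith [(abs_le.1 (hbg x)).2]) (by
        rw [integral_add (integrable_const 1) (hgi.const_mul b), integral_const_mul, hg0]
        simp)
    refine ⟨η, h1, h2', h3, ?_⟩
    rw [← h4]
    have : ∫ y, (1 + b * g y) * y ∂L = μ + c * b := by
      simp_rw [add_mul, one_mul, mul_assoc]
      rw [integral_add hid (hgx.const_mul b), integral_const_mul, hμ, mul_comm c b]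
    rw [this]
  -- The tilts `d - p` with `d = 1, 0` average to zero under the weights `p`, `1 - p`, so the two
  -- densities average to `1`.
  obtain ⟨η₁, h11, h12, h13, h14⟩ := hdens (1 - p) (abs_le.2 ⟨by linarith, by linarith⟩)
  obtain ⟨η₀, h01, h02, h03, h04⟩ := hdens (0 - p) (abs_le.2 ⟨by linarith, by linarith⟩)
  refine ⟨c, η₁, η₀, hc0, h11, h01, h12, h02, h13, h03, ?_⟩
  have hm : ∀ b : ℝ, Measurable fun x ↦ ENNReal.ofReal (1 + b * g x) := fun b ↦
    ((hgm.const_mul b).const_add 1).ennreal_ofReal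
  rw [h14, h04, ← withDensity_smul _ (hm _), ← withDensity_smul _ (hm _),
    ← withDensity_add_left ((hm _).const_smul _)]
  convert withDensity_one (μ := L) using 2
  ext x
  have hbd : ∀ b : ℝ, |b| ≤ 1 → 0 ≤ 1 + b * g x := fun b hb ↦ by
    have : |b * g x| ≤ 1 := by
      rw [abs_mul]
      exact mul_le_one₀ hb (abs_nonneg _) (hgabs x)
    linarith [(abs_le.1 this).1]
  have e1 := hbd (1 - p) (abs_le.2 ⟨by linarith, by linarith⟩)
  have e0 := hbd (0 - p) (abs_le.2 ⟨by linarith, by linarith⟩)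
  simp only [Pi.add_apply, Pi.smul_apply, smul_eq_mul, Pi.one_apply]
  rw [← ENNReal.ofReal_mul hp0, ← ENNReal.ofReal_mul (by linarith),
    ← ENNReal.ofReal_add (mul_nonneg hp0 e1) (mul_nonneg (by linarith) e0),
    ← ENNReal.ofReal_one]
  congr 1
  ring

/-- Second order expansion of the characteristic function of a centred law. -/
theorem tendsto_mul_charFun_sub_one {η : Measure ℝ} [IsProbabilityMeasure η] (h2 : MemLp id 2 η)
    (h0 : ∫ x, x ∂η = 0) (t : ℝ) :
    Tendsto (fun n : ℕ ↦ (n : ℂ) * (charFun η ((√n)⁻¹ * t) - 1)) atTop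
      (𝓝 ((-((∫ x, x ^ 2 ∂η) * t ^ 2 / 2) : ℝ) : ℂ)) := by
  set v := ∫ x, x ^ 2 ∂η with hv
  have hT : ∀ s : ℝ, taylorWithinEval (charFun η) 2 Set.univ 0 s = 1 - v * s ^ 2 / 2 := by
    intro s
    have := taylorWithinEval_charFun_two_zero (P := η) (X := id) aemeasurable_id
      (by simpa using h2) s
    rw [Measure.map_id] at this
    rw [this]
    simp [h0, hv]
  have hO : (fun s : ℝ ↦ charFun η s - (1 - v * s ^ 2 / 2)) =o[𝓝 0] fun s : ℝ ↦ s ^ 2 := by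
    have := taylor_isLittleO_univ (f := charFun η) (x₀ := 0) (n := 2) (contDiff_charFun h2)
    simpa only [hT, sub_zero] using this
  have hs : Tendsto (fun n : ℕ ↦ (√(n : ℝ))⁻¹ * t) atTop (𝓝 0) := by
    rw [← zero_mul t]
    exact .mul_const t (tendsto_inv_atTop_zero.comp <| Real.tendsto_sqrt_atTop.comp <|
      tendsto_natCast_atTop_atTop)
  have hO2 := hO.comp_tendsto hs
  have hO3 : (fun n : ℕ ↦ charFun η ((√n)⁻¹ * t) - (1 - v * ((√n)⁻¹ * t : ℝ) ^ 2 / 2))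
      =o[atTop] fun n : ℕ ↦ ((n : ℂ)⁻¹) := by
    refine hO2.trans_isBigO ?_
    refine Asymptotics.IsBigO.of_bound (t ^ 2) (Eventually.of_forall fun n ↦ ?_)
    simp [mul_pow, mul_comm]
  have hlim := hO3.tendsto_div_nhds_zero
  have hlim2 := hlim.add_const ((-(v * t ^ 2 / 2) : ℝ) : ℂ)
  rw [zero_add] at hlim2
  refine hlim2.congr' ?_
  filter_upwards [eventually_ne_atTop 0] with n hn
  have hsq : (((√(n : ℝ))⁻¹ * t : ℝ) : ℂ) ^ 2 = (n : ℂ)⁻¹ * t ^ 2 := by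
    rw [← Complex.ofReal_pow, mul_pow, inv_pow, Real.sq_sqrt (Nat.cast_nonneg n)]
    push_cast
    rfl
  have hn' : (n : ℂ) ≠ 0 := by exact_mod_cast hn
  rw [hsq, div_inv_eq_mul]
  push_cast
  field_simp
  ring

/-- The characteristic function of a centred law, compared with that of a normal law. -/
theorem tendsto_mul_charFun_sub_exp {η : Measure ℝ} [IsProbabilityMeasure η] (h2 : MemLp id 2 η)
    (h0 : ∫ x, x ∂η = 0) (t : ℝ) :
    Tendsto (fun n : ℕ ↦ (n : ℝ) * ‖charFun η ((√n)⁻¹ * t) -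
      (Real.exp (-((∫ x, x ^ 2 ∂η) * t ^ 2 / 2) / n) : ℂ)‖) atTop (𝓝 0) := by
  set α := -((∫ x, x ^ 2 ∂η) * t ^ 2 / 2) with hα
  have h1 := tendsto_mul_charFun_sub_one h2 h0 t
  rw [← hα] at h1
  -- Both `n (charFun - 1)` and `n (exp (α / n) - 1)` tend to `α`, the latter being a difference
  -- quotient of `exp (α x)` at `0`.
  have h3 : Tendsto (fun n : ℕ ↦ (n : ℝ) * (Real.exp (α / n) - 1)) atTop (𝓝 α) := by
    have hd : HasDerivAt (fun x : ℝ ↦ Real.exp (α * x)) α 0 := by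
      simpa using ((hasDerivAt_id (0 : ℝ)).const_mul α).exp
    have hz : Tendsto (fun n : ℕ ↦ (n : ℝ)⁻¹) atTop (𝓝[≠] 0) := by
      refine tendsto_nhdsWithin_iff.2
        ⟨tendsto_inv_atTop_zero.comp tendsto_natCast_atTop_atTop, ?_⟩
      filter_upwards [eventually_ne_atTop 0] with n hn
      simpa using hn
    refine (hd.tendsto_slope_zero.comp hz).congr fun n ↦ ?_
    simp [div_eq_mul_inv]
  have h4 : Tendsto (fun n : ℕ ↦ (n : ℂ) * ((Real.exp (α / n) : ℂ) - 1)) atTop (𝓝 (α : ℂ)) := by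
    refine ((Complex.continuous_ofReal.tendsto α).comp h3).congr fun n ↦ ?_
    simp only [Function.comp_apply]
    push_cast
    rfl
  have h5 := (h1.sub h4).norm
  rw [sub_self, norm_zero] at h5
  refine h5.congr fun n ↦ ?_
  rw [← mul_sub, norm_mul, sub_sub_sub_cancel_right, Complex.norm_natCast]

/-- Factors are exchanged one at a time, while all the others have norm at most `1`. -/
theorem norm_prod_sub_prod_le_sum {ι : Type*} (s : Finset ι) {f g : ι → ℂ}
    (hf : ∀ i ∈ s, ‖f i‖ ≤ 1) (hg : ∀ i ∈ s, ‖g i‖ ≤ 1) :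
    ‖∏ i ∈ s, f i - ∏ i ∈ s, g i‖ ≤ ∑ i ∈ s, ‖f i - g i‖ := by
  classical
  induction s using Finset.induction_on with
  | empty => simp
  | insert a s ha ih =>
    have ih' := ih (fun i hi ↦ hf i (Finset.mem_insert_of_mem hi))
      (fun i hi ↦ hg i (Finset.mem_insert_of_mem hi))
    have hP : ‖∏ i ∈ s, f i‖ ≤ 1 := by
      rw [norm_prod]
      exact Finset.prod_le_one (fun i _ ↦ norm_nonneg _)
        fun i hi ↦ hf i (Finset.mem_insert_of_mem hi)
    rw [Finset.prod_insert ha, Finset.prod_insert ha, Finset.sum_insert ha]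
    have h1 : f a * ∏ i ∈ s, f i - g a * ∏ i ∈ s, g i
        = (f a - g a) * ∏ i ∈ s, f i + g a * (∏ i ∈ s, f i - ∏ i ∈ s, g i) := by ring
    rw [h1]
    refine (norm_add_le _ _).trans ?_
    rw [norm_mul, norm_mul]
    refine add_le_add (mul_le_of_le_one_right (norm_nonneg _) hP) ?_
    exact (mul_le_of_le_one_left (norm_nonneg _) (hg a (Finset.mem_insert_self a s))).trans ih'

/-- The derivative of `exp` is at most `1` on the nonpositive half-line. -/
theorem abs_exp_sub_exp_le_of_nonpos {x y : ℝ} (hx : x ≤ 0) (hy : y ≤ 0) :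
    |Real.exp x - Real.exp y| ≤ |x - y| := by
  wlog h : y ≤ x generalizing x y
  · rw [abs_sub_comm, abs_sub_comm x y]
    exact this hy hx (le_of_not_ge h)
  rw [abs_of_nonneg (sub_nonneg.2 (Real.exp_le_exp.2 h)), abs_of_nonneg (sub_nonneg.2 h)]
  have h1 := Real.add_one_le_exp (y - x)
  have h2 : Real.exp y = Real.exp x * Real.exp (y - x) := by rw [← Real.exp_add]; ring_nf
  have h3 : Real.exp x ≤ 1 := Real.exp_le_one_iff.2 hx
  have h4 := Real.exp_pos x
  rw [h2]
  nlinarith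

/-- If the sum of an independent centred normal variable and a multiple of a variable is normal,
then so is that variable. -/
theorem IsNormalLaw.of_conv_gaussianReal {ν : Measure ℝ} [IsProbabilityMeasure ν] {r : ℝ}
    (hr : r ≠ 0) {w : NNReal} (h : IsNormalLaw ((ν.map (r * ·)) ∗ gaussianReal 0 w)) :
    IsNormalLaw ν := by
  obtain ⟨a, v, h⟩ := h
  have : IsProbabilityMeasure (ν.map (r * ·)) := Measure.isProbabilityMeasure_map (by fun_prop)
  have hc : ∀ t : ℝ, charFun (ν.map (r * ·)) t
      = Complex.exp (t * a * I - ((v : ℝ) - (w : ℝ) : ℝ) * t ^ 2 / 2) := by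
    intro t
    have h1 : charFun ((ν.map (r * ·)) ∗ gaussianReal 0 w) t = charFun (gaussianReal a v) t := by
      rw [h]
    rw [charFun_conv, charFun_gaussianReal, charFun_gaussianReal] at h1
    rw [← eq_div_iff (by simp)] at h1
    rw [h1, ← Complex.exp_sub]
    congr 1
    push_cast
    ring
  -- Otherwise the quotient of the two normal characteristic functions would exceed `1` in norm at
  -- `1`.
  have hwv : w ≤ v := by
    have h1 := norm_charFun_le_one (μ := ν.map (r * ·)) (1 : ℝ)
    rw [hc, Complex.norm_exp, Real.exp_le_one_iff] at h1
    have h2 : (w : ℝ) ≤ v := by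
      simp at h1
      linarith
    exact_mod_cast h2
  have hg : ν.map (r * ·) = gaussianReal a (v - w) := by
    refine Measure.ext_of_charFun ?_
    ext t
    rw [hc, charFun_gaussianReal]
    have : (((v - w : NNReal) : ℝ)) = (v : ℝ) - w := NNReal.coe_sub hwv
    simp only [← this]
  have hν : ν = (gaussianReal a (v - w)).map (r⁻¹ * ·) := by
    rw [← hg, Measure.map_map (by fun_prop) (by fun_prop)]
    convert Measure.map_id.symm
    ext x
    simp [hr]
  rw [hν, gaussianReal_map_const_mul]
  exact ⟨_, _, rfl⟩

end Probability

/-! ### The mixture variables: marginal law, independence, conditional characteristic function. -/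

section Mixture

open Complex (I)
open scoped Topology

variable {E Ω : Type*} {mΩ : MeasurableSpace Ω}

open Classical in
/-- The noise at `k`: the first or the second coordinate of `x`, depending on whether the
event `A k` occurs. -/
noncomputable def mixNoise (A : E → Set Ω) (k : E) (ω : Ω) (x : ℝ × ℝ) : ℝ :=
  if ω ∈ A k then x.1 else x.2

/-- A variable with conditional mean `μ + c * (1_A - p)` given the events `A`, plus noise. -/
noncomputable def mixVar (A : E → Set Ω) (μ c p : ℝ) (k : E) (z : Ω × (E → ℝ × ℝ)) : ℝ :=
  μ + c * ((A k).indicator 1 z.1 - p) + mixNoise A k z.1 (z.2 k)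

variable {A : E → Set Ω} {μ c p : ℝ} {k : E} {P : Measure Ω} [IsProbabilityMeasure P]
  {η₁ η₀ : Measure ℝ} [IsProbabilityMeasure η₁] [IsProbabilityMeasure η₀]

theorem measurable_mixNoise (ω : Ω) : Measurable (mixNoise A k ω) := by
  unfold mixNoise
  split_ifs
  · exact measurable_fst
  · exact measurable_snd

theorem measurable_mixNoise_prod (hA : MeasurableSet (A k)) :
    Measurable fun z : Ω × (E → ℝ × ℝ) ↦ mixNoise A k z.1 (z.2 k) := by
  unfold mixNoise
  exact Measurable.ite (measurable_fst hA) (by fun_prop) (by fun_prop)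

theorem measurable_mixVar (hA : MeasurableSet (A k)) : Measurable (mixVar A μ c p k) := by
  have h1 : Measurable ((A k).indicator (1 : Ω → ℝ)) := measurable_one.indicator hA
  exact ((((h1.comp measurable_fst).sub_const p).const_mul c).const_add μ).add
    (measurable_mixNoise_prod hA)

theorem map_infinitePi_comp_eval {α β : Type*} [MeasurableSpace α] [MeasurableSpace β]
    {R : Measure α} [IsProbabilityMeasure R] {f : α → β} (hf : Measurable f) (k : E) :
    (Measure.infinitePi fun _ : E ↦ R).map (fun u ↦ f (u k)) = R.map f := by
  have h := congrArg (Measure.map f) (Measure.infinitePi_map_eval (fun _ : E ↦ R) k)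
  rw [Measure.map_map hf (by fun_prop)] at h
  exact h

/-- Given `ω`, only the noise at `k` is random, and its law is `η₁` or `η₀` according to `A k`;
integrating over `ω` weights the two cases by `p` and `1 - p`. -/
theorem map_mixVar (hA : MeasurableSet (A k)) (hp0 : 0 ≤ p)
    (hPA : P (A k) = ENNReal.ofReal p) :
    (P.prod (Measure.infinitePi fun _ : E ↦ η₁.prod η₀)).map (mixVar A μ c p k) =
      ENNReal.ofReal p • η₁.map (fun x ↦ μ + c * (1 - p) + x) +
        ENNReal.ofReal (1 - p) • η₀.map (fun x ↦ μ + c * (0 - p) + x) := by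
  have hPAc : P (A k)ᶜ = ENNReal.ofReal (1 - p) := by
    rw [prob_compl_eq_one_sub hA, hPA, ENNReal.ofReal_sub _ hp0, ENNReal.ofReal_one]
  ext B hB
  have hB' := measurable_mixVar (μ := μ) (c := c) (p := p) hA hB
  rw [Measure.map_apply (measurable_mixVar hA) hB, Measure.prod_apply hB']
  have hpre : ∀ (a : ℝ) (f : ℝ × ℝ → ℝ), Measurable f →
      (Measure.infinitePi fun _ : E ↦ η₁.prod η₀) {u : E → ℝ × ℝ | a + f (u k) ∈ B}
        = ((η₁.prod η₀).map f).map (fun x ↦ a + x) B := by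
    intro a f hf
    rw [← map_infinitePi_comp_eval hf k, Measure.map_map (by fun_prop) (by fun_prop),
      Measure.map_apply (by fun_prop) hB]
    rfl
  have hint : ∀ ω, (Measure.infinitePi fun _ : E ↦ η₁.prod η₀)
      (Prod.mk ω ⁻¹' (mixVar A μ c p k ⁻¹' B))
      = (A k).indicator (fun _ ↦ η₁.map (fun x ↦ μ + c * (1 - p) + x) B) ω
        + (A k)ᶜ.indicator (fun _ ↦ η₀.map (fun x ↦ μ + c * (0 - p) + x) B) ω := by
    intro ω
    by_cases hω : ω ∈ A k
    · have := hpre (μ + c * (1 - p)) Prod.fst measurable_fst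
      rw [Measure.map_fst_prod, measure_univ, one_smul] at this
      simp only [Set.indicator_of_mem hω, Set.indicator_of_notMem (Set.notMem_compl_iff.2 hω),
        add_zero, ← this]
      simp only [Set.preimage, mixVar, mixNoise, hω, Set.indicator_of_mem, Pi.one_apply, if_true,
        Set.mem_ofPred_eq]
    · have := hpre (μ + c * (0 - p)) Prod.snd measurable_snd
      rw [Measure.map_snd_prod, measure_univ, one_smul] at this
      simp only [Set.indicator_of_notMem hω, Set.indicator_of_mem (Set.mem_compl hω),
        zero_add, ← this]
      simp only [Set.preimage, mixVar, mixNoise, hω, Set.indicator_of_notMem, not_false_eq_true,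
        if_false, Set.mem_ofPred_eq]
  rw [lintegral_congr hint, lintegral_add_left (measurable_const.indicator hA),
    lintegral_indicator_const hA, lintegral_indicator_const hA.compl, hPA, hPAc]
  simp [mul_comm]

/-- Each variable is one fixed function of the indicator of its event and of its own noise pair, and
these form two independent families on separate factors. -/
theorem iIndepFun_mixVar {ι : Type*} {t : ι → E} (ht : Function.Injective t)
    (hA : ∀ j, MeasurableSet (A (t j))) (hind : iIndepSet (fun j ↦ A (t j)) P) :
    iIndepFun (fun j ↦ mixVar A μ c p (t j))
      (P.prod (Measure.infinitePi fun _ : E ↦ η₁.prod η₀)) := by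
  classical
  have h1 : iIndepFun (fun j ↦ (A (t j)).indicator fun _ ↦ (1 : ℝ)) P := hind.iIndepFun_indicator
  have h2 : iIndepFun (fun j (u : E → ℝ × ℝ) ↦ u (t j))
      (Measure.infinitePi fun _ : E ↦ η₁.prod η₀) :=
    (iIndepFun_infinitePi (P := fun _ : E ↦ η₁.prod η₀) (X := fun _ x ↦ x)
      fun _ ↦ measurable_id).precomp ht
  have h3 := iIndepFun_prod_of_iIndepFun (fun j ↦ measurable_const.indicator (hA j))
    (fun j ↦ by fun_prop) h1 h2
    (F := fun y : ℝ × (ℝ × ℝ) ↦ μ + c * (y.1 - p) + if y.1 = 1 then y.2.1 else y.2.2)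
    (Measurable.add (by fun_prop) (Measurable.ite
      (measurable_fst (measurableSet_singleton (1 : ℝ))) (by fun_prop) (by fun_prop)))
  convert h3 using 3 with j z
  by_cases hz : z.1 ∈ A (t j) <;> simp [mixVar, mixNoise, hz]

open Classical in
/-- Conditioning on the events `A`, the noise is independent. -/
theorem charFun_map_add_sum_mixNoise {s : Finset E} (hA : ∀ k ∈ s, MeasurableSet (A k))
    {a : Ω → ℝ} (ha : Measurable a) (b t : ℝ) :
    charFun ((P.prod (Measure.infinitePi fun _ : E ↦ η₁.prod η₀)).map
        (fun z ↦ a z.1 + b * ∑ k ∈ s, mixNoise A k z.1 (z.2 k))) t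
      = ∫ ω, Complex.exp (t * a ω * I) *
          ∏ k ∈ s, (if ω ∈ A k then charFun η₁ (b * t) else charFun η₀ (b * t)) ∂P := by
  have hm : Measurable fun z : Ω × (E → ℝ × ℝ) ↦
      a z.1 + b * ∑ k ∈ s, mixNoise A k z.1 (z.2 k) :=
    (ha.comp measurable_fst).add
      ((Finset.measurable_fun_sum s fun k hk ↦ measurable_mixNoise_prod (hA k hk)).const_mul b)
  have hexp : Measurable fun z : Ω × (E → ℝ × ℝ) ↦
      Complex.exp (t * (a z.1 + b * ∑ k ∈ s, mixNoise A k z.1 (z.2 k) : ℝ) * I) :=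
    Complex.measurable_exp.comp
      (((Complex.measurable_ofReal.comp hm).const_mul (t : ℂ)).mul_const I)
  rw [charFun_apply_real, integral_map hm.aemeasurable (by fun_prop), integral_prod]
  · refine integral_congr_ae (ae_of_all _ fun ω ↦ ?_)
    have hsum : Measurable fun u : E → ℝ × ℝ ↦ ∑ k ∈ s, mixNoise A k ω (u k) :=
      Finset.measurable_fun_sum s fun k _ ↦ (measurable_mixNoise ω).comp (measurable_pi_apply k)
    have h2 : iIndepFun (fun k (u : E → ℝ × ℝ) ↦ mixNoise A k ω (u k))
        (Measure.infinitePi fun _ : E ↦ η₁.prod η₀) :=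
      iIndepFun_infinitePi (P := fun _ : E ↦ η₁.prod η₀) (X := fun k x ↦ mixNoise A k ω x)
        fun k ↦ measurable_mixNoise ω
    have h3 := congrFun ((h2.restrict s).charFun_map_fun_finsetSum_eq_prod
      (s := s) (X := fun k (u : E → ℝ × ℝ) ↦ mixNoise A k ω (u k))
      (fun k _ ↦ ((measurable_mixNoise ω).comp (measurable_pi_apply k)).aemeasurable))
      (b * t)
    rw [charFun_apply_real, integral_map hsum.aemeasurable (by fun_prop), Finset.prod_apply] at h3
    have h4 : ∀ k, charFun ((Measure.infinitePi fun _ : E ↦ η₁.prod η₀).map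
        fun u ↦ mixNoise A k ω (u k)) (b * t)
        = if ω ∈ A k then charFun η₁ (b * t) else charFun η₀ (b * t) := by
      intro k
      have h5 : (Measure.infinitePi fun _ : E ↦ η₁.prod η₀).map (fun u ↦ mixNoise A k ω (u k))
          = (η₁.prod η₀).map (mixNoise A k ω) :=
        map_infinitePi_comp_eval (measurable_mixNoise ω) k
      rw [h5]
      by_cases hω : ω ∈ A k
      · rw [if_pos hω, show mixNoise A k ω = Prod.fst by ext x; simp [mixNoise, hω],
          Measure.map_fst_prod, measure_univ, one_smul]
      · rw [if_neg hω, show mixNoise A k ω = Prod.snd by ext x; simp [mixNoise, hω],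
          Measure.map_snd_prod, measure_univ, one_smul]
    rw [Finset.prod_congr rfl fun k _ ↦ h4 k] at h3
    simp only
    rw [← h3, ← integral_const_mul]
    refine integral_congr_ae (ae_of_all _ fun u ↦ ?_)
    simp only
    rw [← Complex.exp_add]
    congr 1
    push_cast
    ring
  · refine Integrable.of_bound hexp.aestronglyMeasurable 1 (ae_of_all _ fun z ↦ ?_)
    rw [← Complex.ofReal_mul, Complex.norm_exp_ofReal_mul_I]

/-- The weak law of large numbers for pairwise independent events, in mean. -/
theorem integral_abs_sum_indicator_le {s : Finset E} (hs : s.Nonempty)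
    (hA : ∀ k ∈ s, MeasurableSet (A k)) (hp0 : 0 ≤ p)
    (hPA : ∀ k ∈ s, P (A k) = ENNReal.ofReal p)
    (hind : (s : Set E).Pairwise fun i j ↦
      IndepFun ((A i).indicator (1 : Ω → ℝ)) ((A j).indicator (1 : Ω → ℝ)) P) :
    ∫ ω, |(s.card : ℝ)⁻¹ * ∑ k ∈ s, (A k).indicator 1 ω - p| ∂P ≤ (√(s.card : ℝ))⁻¹ := by
  set n : ℝ := (s.card : ℝ) with hn
  have hnpos : 0 < n := by
    rw [hn]
    exact_mod_cast hs.card_pos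
  let D : E → Ω → ℝ := fun k ↦ (A k).indicator 1
  have hDm : ∀ k ∈ s, Measurable (D k) := fun k hk ↦ measurable_one.indicator (hA k hk)
  have hDb : ∀ k ω, 0 ≤ D k ω ∧ D k ω ≤ 1 := fun k ω ↦ by
    by_cases h : ω ∈ A k <;> simp [D, h]
  have hDL : ∀ k ∈ s, MemLp (D k) 2 P := fun k hk ↦
    MemLp.of_bound (hDm k hk).aestronglyMeasurable 1
      (ae_of_all _ fun ω ↦ by rw [Real.norm_eq_abs, abs_of_nonneg (hDb k ω).1]; exact (hDb k ω).2)
  have hDi : ∀ k ∈ s, ∫ ω, D k ω ∂P = p := fun k hk ↦ by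
    simp only [D]
    rw [integral_indicator_one (hA k hk), measureReal_def, hPA k hk, ENNReal.toReal_ofReal hp0]
  have hvar : variance (∑ k ∈ s, D k) P ≤ n := by
    rw [IndepFun.variance_sum hDL]
    · rw [hn, ← nsmul_one, ← Finset.sum_const]
      refine Finset.sum_le_sum fun k hk ↦ ?_
      refine (variance_le_sq_of_bounded (a := 0) (b := 1)
        (ae_of_all _ fun ω ↦ ⟨(hDb k ω).1, (hDb k ω).2⟩) (hDm k hk).aemeasurable).trans ?_
      norm_num
    · intro i hi j hj hij
      exact hind hi hj hij
  have hSL : MemLp (∑ k ∈ s, D k) 2 P := memLp_finsetSum' s hDL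
  have hmean : P[∑ k ∈ s, D k] = n * p := by
    simp only [Finset.sum_apply]
    rw [integral_finsetSum _ fun k hk ↦ (hDL k hk).integrable one_le_two,
      Finset.sum_congr rfl hDi]
    simp [hn]
  rw [variance_eq_integral hSL.aemeasurable, hmean] at hvar
  have hsq : Integrable (fun ω ↦ ((∑ k ∈ s, D k) ω - n * p) ^ 2) P :=
    (hSL.sub (memLp_const _)).integrable_sq
  -- The arithmetic-geometric mean inequality, weighted so that with variance at most `n` both terms
  -- contribute `(√n)⁻¹ / 2`.
  have hbound : ∀ ω, |n⁻¹ * ∑ k ∈ s, (A k).indicator 1 ω - p|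
      ≤ (√n)⁻¹ / 2 + (n * √n)⁻¹ / 2 * ((∑ k ∈ s, D k) ω - n * p) ^ 2 := by
    intro ω
    have h1 : n⁻¹ * ∑ k ∈ s, (A k).indicator 1 ω - p = n⁻¹ * ((∑ k ∈ s, D k) ω - n * p) := by
      simp only [Finset.sum_apply, D]
      field_simp
    rw [h1]
    set y := (∑ k ∈ s, D k) ω - n * p
    have hr : 0 < √n := Real.sqrt_pos.2 hnpos
    have hrr : √n * √n = n := Real.mul_self_sqrt hnpos.le
    rw [abs_mul, abs_of_pos (inv_pos.2 hnpos), ← sq_abs y]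
    set r := √n
    have h2 : r⁻¹ / 2 + (n * r)⁻¹ / 2 * |y| ^ 2 - n⁻¹ * |y| = (n * r)⁻¹ / 2 * (|y| - r) ^ 2 := by
      rw [← hrr]
      field_simp
      ring
    have h3 : 0 ≤ (n * r)⁻¹ / 2 * (|y| - r) ^ 2 := by positivity
    linarith
  refine (integral_mono_of_nonneg (ae_of_all _ fun ω ↦ abs_nonneg _)
    ((integrable_const _).add (hsq.const_mul _)) (ae_of_all _ hbound)).trans ?_
  simp only [Pi.add_apply]
  rw [integral_add (integrable_const _) (hsq.const_mul _), integral_const_mul]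
  have hr : 0 < √n := Real.sqrt_pos.2 hnpos
  have h4 := mul_le_mul_of_nonneg_left hvar (by positivity : 0 ≤ (n * √n)⁻¹ / 2)
  have h5 : (n * √n)⁻¹ / 2 * n = (√n)⁻¹ / 2 := by field_simp
  simp only [integral_const, probReal_univ, one_smul]
  linarith

end Mixture

/-! ### Asymptotic separation of the labels and the noise. -/

section Limit

open Complex (I)
open scoped Topology

variable {E Ω : Type*} {mΩ : MeasurableSpace Ω} {A : E → Set Ω} {p : ℝ} {P : Measure Ω}
  [IsProbabilityMeasure P] {η₁ η₀ : Measure ℝ} [IsProbabilityMeasure η₁] [IsProbabilityMeasure η₀]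

-- The product is compared with `exp (y α + (1 - y) β)`, where `y` is the proportion of events that
-- occur, and then `y` is replaced by `p`. Only the last error depends on `ω`, and the law of large
-- numbers controls it in mean.
open Classical in
theorem norm_prod_charFun_sub_exp_le {s : Finset E} (hs : s.Nonempty) {x₁ x₀ : ℂ}
    (h1 : ‖x₁‖ ≤ 1) (h0 : ‖x₀‖ ≤ 1) {α β : ℝ} (hα : α ≤ 0) (hβ : β ≤ 0) (hp0 : 0 ≤ p)
    (hp1 : p ≤ 1) (ω : Ω) :
    ‖(∏ k ∈ s, if ω ∈ A k then x₁ else x₀) - (Real.exp (p * α + (1 - p) * β) : ℂ)‖ ≤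
      s.card * ‖x₁ - (Real.exp (α / s.card) : ℂ)‖ + s.card * ‖x₀ - (Real.exp (β / s.card) : ℂ)‖ +
        |α - β| * |(s.card : ℝ)⁻¹ * ∑ k ∈ s, (A k).indicator 1 ω - p| := by
  set n : ℝ := (s.card : ℝ) with hn
  have hnpos : 0 < n := by
    rw [hn]
    exact_mod_cast hs.card_pos
  set y : ℝ := n⁻¹ * ∑ k ∈ s, (A k).indicator 1 ω with hy
  have hy0 : 0 ≤ y := mul_nonneg (inv_nonneg.2 hnpos.le)
    (Finset.sum_nonneg fun k _ ↦ Set.indicator_nonneg (fun _ _ ↦ zero_le_one) ω)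
  have hy1 : y ≤ 1 := by
    have : ∑ k ∈ s, (A k).indicator (1 : Ω → ℝ) ω ≤ n := by
      rw [hn, ← nsmul_one, ← Finset.sum_const]
      exact Finset.sum_le_sum fun k _ ↦ Set.indicator_le_self' (fun _ _ ↦ zero_le_one) ω
    rw [hy, inv_mul_le_iff₀ hnpos]
    linarith
  have hprod : ∏ k ∈ s, (if ω ∈ A k then (Real.exp (α / n) : ℂ) else (Real.exp (β / n) : ℂ))
      = (Real.exp (y * α + (1 - y) * β) : ℂ) := by
    have hterm : ∀ k, (if ω ∈ A k then (Real.exp (α / n) : ℂ) else (Real.exp (β / n) : ℂ))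
        = (Real.exp (β / n + (α - β) / n * (A k).indicator 1 ω) : ℂ) := by
      intro k
      by_cases h : ω ∈ A k
      · simp only [h, if_true, Set.indicator_of_mem, Pi.one_apply]
        congr 2
        ring
      · simp [h]
    rw [Finset.prod_congr rfl fun k _ ↦ hterm k, ← Complex.ofReal_prod, ← Real.exp_sum,
      Finset.sum_add_distrib, ← Finset.mul_sum, Finset.sum_const, nsmul_eq_mul, ← hn]
    congr 2
    rw [hy]
    field_simp
    ring
  have hexp : ∀ a : ℝ, a ≤ 0 → ‖(Real.exp (a / n) : ℂ)‖ ≤ 1 := by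
    intro a ha
    rw [Complex.norm_real, Real.norm_eq_abs, abs_of_pos (Real.exp_pos _), Real.exp_le_one_iff]
    exact div_nonpos_of_nonpos_of_nonneg ha hnpos.le
  have hA1 := norm_prod_sub_prod_le_sum s (f := fun k ↦ if ω ∈ A k then x₁ else x₀)
    (g := fun k ↦ if ω ∈ A k then (Real.exp (α / n) : ℂ) else (Real.exp (β / n) : ℂ))
    (fun k _ ↦ by split_ifs <;> assumption)
    (fun k _ ↦ by split_ifs; exacts [hexp α hα, hexp β hβ])
  rw [hprod] at hA1
  have hA2 : ∑ k ∈ s, ‖(if ω ∈ A k then x₁ else x₀) -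
      (if ω ∈ A k then (Real.exp (α / n) : ℂ) else (Real.exp (β / n) : ℂ))‖
      ≤ n * ‖x₁ - (Real.exp (α / n) : ℂ)‖ + n * ‖x₀ - (Real.exp (β / n) : ℂ)‖ := by
    rw [← mul_add, hn, ← nsmul_eq_mul, ← Finset.sum_const]
    refine Finset.sum_le_sum fun k _ ↦ ?_
    split_ifs
    · exact le_add_of_nonneg_right (norm_nonneg _)
    · exact le_add_of_nonneg_left (norm_nonneg _)
  have hA3 : ‖(Real.exp (y * α + (1 - y) * β) : ℂ) - (Real.exp (p * α + (1 - p) * β) : ℂ)‖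
      ≤ |α - β| * |y - p| := by
    rw [← Complex.ofReal_sub, Complex.norm_real, Real.norm_eq_abs]
    refine (abs_exp_sub_exp_le_of_nonpos ?_ ?_).trans (le_of_eq ?_)
    · nlinarith
    · nlinarith
    · rw [← abs_mul]
      congr 1
      ring
  calc _ ≤ _ := norm_sub_le_norm_sub_add_norm_sub _ (Real.exp (y * α + (1 - y) * β) : ℂ) _
    _ ≤ _ := add_le_add (hA1.trans hA2) hA3

/-- The characteristic functions of the standardized sums of the mixture variables. -/
theorem tendsto_charFun_sum_mixVar {s : ℕ → Finset E} {μ c σ : ℝ} {ν : Measure ℝ}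
    (hσ : 0 < σ) (hp0 : 0 < p) (hp1 : p < 1)
    (h12 : MemLp id 2 η₁) (h02 : MemLp id 2 η₀) (h1 : ∫ x, x ∂η₁ = 0) (h0 : ∫ x, x ∂η₀ = 0)
    (hs : Tendsto (fun m ↦ (s m).card) atTop atTop)
    (hA : ∀ m, ∀ k ∈ s m, MeasurableSet (A k))
    (hPA : ∀ m, ∀ k ∈ s m, P (A k) = ENNReal.ofReal p)
    (hind : ∀ m, (s m : Set E).Pairwise fun i j ↦
      IndepFun ((A i).indicator (1 : Ω → ℝ)) ((A j).indicator (1 : Ω → ℝ)) P)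
    {t : ℝ}
    (hξ : Tendsto (fun m ↦ charFun (P.map fun ω ↦ ((∑ k ∈ s m, (A k).indicator 1 ω) -
        ((s m).card : ℝ) * p) / √(((s m).card : ℝ) * p * (1 - p))) (c * √(p * (1 - p)) / σ * t))
      atTop (𝓝 (charFun ν (c * √(p * (1 - p)) / σ * t)))) :
    Tendsto (fun m ↦ charFun ((P.prod (Measure.infinitePi fun _ : E ↦ η₁.prod η₀)).map fun z ↦
        ((∑ k ∈ s m, mixVar A μ c p k z) - ((s m).card : ℝ) * μ) / (σ * √((s m).card : ℝ))) t)
      atTop (𝓝 (charFun ν (c * √(p * (1 - p)) / σ * t) *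
        (Real.exp (p * (-((∫ x, x ^ 2 ∂η₁) * (t / σ) ^ 2 / 2)) +
          (1 - p) * (-((∫ x, x ^ 2 ∂η₀) * (t / σ) ^ 2 / 2))) : ℂ))) := by
  classical
  set r := c * √(p * (1 - p)) / σ with hr
  set α := -((∫ x, x ^ 2 ∂η₁) * (t / σ) ^ 2 / 2) with hα
  set β := -((∫ x, x ^ 2 ∂η₀) * (t / σ) ^ 2 / 2) with hβ
  let n : ℕ → ℝ := fun m ↦ ((s m).card : ℝ)
  let ξ : ℕ → Ω → ℝ := fun m ω ↦ ((∑ k ∈ s m, (A k).indicator 1 ω) - n m * p) /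
    √(n m * p * (1 - p))
  have hq : 0 < p * (1 - p) := mul_pos hp0 (by linarith)
  have hα0 : α ≤ 0 := by
    have : 0 ≤ ∫ x, x ^ 2 ∂η₁ := integral_nonneg fun x ↦ sq_nonneg x
    rw [hα]
    have := mul_nonneg this (sq_nonneg (t / σ))
    linarith
  have hβ0 : β ≤ 0 := by
    have : 0 ≤ ∫ x, x ^ 2 ∂η₀ := integral_nonneg fun x ↦ sq_nonneg x
    rw [hβ]
    have := mul_nonneg this (sq_nonneg (t / σ))
    linarith
  have hNm : ∀ m, Measurable fun ω ↦ ∑ k ∈ s m, (A k).indicator (1 : Ω → ℝ) ω := fun m ↦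
    Finset.measurable_fun_sum _ fun k hk ↦ measurable_one.indicator (hA m k hk)
  have hξm : ∀ m, Measurable (ξ m) := fun m ↦ ((hNm m).sub_const _).div_const _
  have hdecomp : ∀ m z, ((∑ k ∈ s m, mixVar A μ c p k z) - n m * μ) / (σ * √(n m))
      = r * ξ m z.1 + (σ * √(n m))⁻¹ * ∑ k ∈ s m, mixNoise A k z.1 (z.2 k) := by
    intro m z
    have h3 : √(n m * p * (1 - p)) = √(n m) * √(p * (1 - p)) := by
      rw [mul_assoc, Real.sqrt_mul (Nat.cast_nonneg _)]
    have h4 : √(p * (1 - p)) ≠ 0 := (Real.sqrt_pos.2 hq).ne'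
    have h5 : ∑ k ∈ s m, mixVar A μ c p k z = n m * μ +
        c * ((∑ k ∈ s m, (A k).indicator 1 z.1) - n m * p) +
        ∑ k ∈ s m, mixNoise A k z.1 (z.2 k) := by
      simp only [mixVar, Finset.sum_add_distrib, Finset.sum_const, nsmul_eq_mul, n,
        ← Finset.mul_sum, Finset.sum_sub_distrib]
    simp only [ξ]
    rw [h5, h3, hr]
    simp only [div_eq_mul_inv, mul_inv]
    field_simp
    ring
  have hform : ∀ m, charFun ((P.prod (Measure.infinitePi fun _ : E ↦ η₁.prod η₀)).map fun z ↦
        ((∑ k ∈ s m, mixVar A μ c p k z) - n m * μ) / (σ * √(n m))) t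
      = ∫ ω, Complex.exp (t * (r * ξ m ω : ℝ) * I) * ∏ k ∈ s m, (if ω ∈ A k then
          charFun η₁ ((√(n m))⁻¹ * (t / σ)) else charFun η₀ ((√(n m))⁻¹ * (t / σ))) ∂P := by
    intro m
    simp_rw [hdecomp]
    rw [charFun_map_add_sum_mixNoise (hA m) ((hξm m).const_mul r)]
    have : (σ * √(n m))⁻¹ * t = (√(n m))⁻¹ * (t / σ) := by
      rw [mul_inv]
      ring
    rw [this]
  set γ := p * α + (1 - p) * β with hγ
  have hcξ : ∀ m, charFun (P.map (ξ m)) (r * t) =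
      ∫ ω, Complex.exp (t * (r * ξ m ω : ℝ) * I) ∂P := by
    intro m
    rw [charFun_apply_real, integral_map (hξm m).aemeasurable (by fun_prop)]
    refine integral_congr_ae (ae_of_all _ fun ω ↦ ?_)
    simp only
    push_cast
    congr 1
    ring
  -- The integrated error bound, depending on `m` only through the number `N` of edges.
  let δ : ℕ → ℝ := fun N ↦
    (N : ℝ) * ‖charFun η₁ ((√N)⁻¹ * (t / σ)) - (Real.exp (α / N) : ℂ)‖ +
    (N : ℝ) * ‖charFun η₀ ((√N)⁻¹ * (t / σ)) - (Real.exp (β / N) : ℂ)‖ +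
    |α - β| * (√(N : ℝ))⁻¹
  have hδ : Tendsto δ atTop (𝓝 0) := by
    have e1 := tendsto_mul_charFun_sub_exp h12 h1 (t / σ)
    have e2 := tendsto_mul_charFun_sub_exp h02 h0 (t / σ)
    have e3 : Tendsto (fun N : ℕ ↦ |α - β| * (√(N : ℝ))⁻¹) atTop (𝓝 (|α - β| * 0)) :=
      (tendsto_inv_atTop_zero.comp <| Real.tendsto_sqrt_atTop.comp <|
        tendsto_natCast_atTop_atTop).const_mul _
    have := (e1.add e2).add e3
    rw [mul_zero, add_zero, add_zero] at this
    exact this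
  have hdiff : Tendsto (fun m ↦ charFun ((P.prod (Measure.infinitePi fun _ : E ↦
      η₁.prod η₀)).map fun z ↦ ((∑ k ∈ s m, mixVar A μ c p k z) - n m * μ) / (σ * √(n m))) t
      - charFun (P.map (ξ m)) (r * t) * (Real.exp γ : ℂ)) atTop (𝓝 0) := by
    refine squeeze_zero_norm' ?_ (hδ.comp hs)
    filter_upwards [hs.eventually_ge_atTop 1] with m hm
    have hne : (s m).Nonempty := Finset.card_pos.1 hm
    rw [hform, hcξ, ← integral_mul_const, ← integral_sub]
    · have hb : ∀ ω, ‖Complex.exp (t * (r * ξ m ω : ℝ) * I) * (∏ k ∈ s m, (if ω ∈ A k then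
          charFun η₁ ((√(n m))⁻¹ * (t / σ)) else charFun η₀ ((√(n m))⁻¹ * (t / σ)))) -
          Complex.exp (t * (r * ξ m ω : ℝ) * I) * (Real.exp γ : ℂ)‖ ≤
          (n m * ‖charFun η₁ ((√(n m))⁻¹ * (t / σ)) - (Real.exp (α / n m) : ℂ)‖ +
          n m * ‖charFun η₀ ((√(n m))⁻¹ * (t / σ)) - (Real.exp (β / n m) : ℂ)‖) +
          |α - β| * |(n m)⁻¹ * ∑ k ∈ s m, (A k).indicator 1 ω - p| := by
        intro ω
        rw [← mul_sub, norm_mul, ← Complex.ofReal_mul, Complex.norm_exp_ofReal_mul_I, one_mul]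
        exact norm_prod_charFun_sub_exp_le hne (norm_charFun_le_one _) (norm_charFun_le_one _)
          hα0 hβ0 hp0.le hp1.le ω
      have hi : Integrable
          (fun ω ↦ |(n m)⁻¹ * ∑ k ∈ s m, (A k).indicator (1 : Ω → ℝ) ω - p|) P := by
        refine Integrable.abs (Integrable.sub (Integrable.const_mul ?_ _) (integrable_const p))
        exact integrable_finsetSum _ fun k hk ↦ (integrable_const (1 : ℝ)).indicator (hA m k hk)
      refine (norm_integral_le_of_norm_le ((integrable_const _).add (hi.const_mul _))
        (ae_of_all _ hb)).trans ?_
      simp only [Pi.add_apply]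
      rw [integral_add (integrable_const _) (hi.const_mul _), integral_const_mul]
      simp only [integral_const, probReal_univ, one_smul, Function.comp_apply, δ]
      have := integral_abs_sum_indicator_le hne (hA m) hp0.le (hPA m) (hind m)
      gcongr
    · refine Integrable.of_bound (Measurable.aestronglyMeasurable ?_) 1 (ae_of_all _ fun ω ↦ ?_)
      · refine Measurable.mul ?_ ?_
        · exact Complex.measurable_exp.comp (((Complex.measurable_ofReal.comp
            ((hξm m).const_mul r)).const_mul (t : ℂ)).mul_const I)
        · exact Finset.measurable_fun_prod _ fun k hk ↦
            Measurable.ite (hA m k hk) measurable_const measurable_const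
      · rw [norm_mul, ← Complex.ofReal_mul, Complex.norm_exp_ofReal_mul_I, one_mul, norm_prod]
        refine Finset.prod_le_one (fun _ _ ↦ norm_nonneg _) fun k _ ↦ ?_
        split_ifs <;> exact norm_charFun_le_one _
    · refine Integrable.mul_const (Integrable.of_bound (Measurable.aestronglyMeasurable ?_) 1
        (ae_of_all _ fun ω ↦ ?_)) _
      · exact Complex.measurable_exp.comp (((Complex.measurable_ofReal.comp
            ((hξm m).const_mul r)).const_mul (t : ℂ)).mul_const I)
      · rw [← Complex.ofReal_mul, Complex.norm_exp_ofReal_mul_I]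
  have hfin := hdiff.add (hξ.mul_const (Real.exp γ : ℂ))
  rw [zero_add] at hfin
  refine hfin.congr fun m ↦ ?_
  exact sub_add_cancel _ _

end Limit

/-! ### Independence under an image measure. -/

section Transfer

variable {Ω₁ Ω₂ : Type*} {m₁ : MeasurableSpace Ω₁} {m₂ : MeasurableSpace Ω₂}

theorem iIndepFun_map_of_comp {ι β : Type*} [MeasurableSpace β] {P : Measure Ω₁} {Φ : Ω₁ → Ω₂}
    (hΦ : Measurable Φ) {X : ι → Ω₂ → β} (hX : ∀ i, Measurable (X i))
    (h : iIndepFun (fun i ↦ X i ∘ Φ) P) : iIndepFun X (P.map Φ) := by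
  rw [iIndepFun_iff_measure_inter_preimage_eq_mul] at h ⊢
  intro S B hB
  rw [Measure.map_apply hΦ (Finset.measurableSet_biInter _ fun i hi ↦ hX i (hB i hi)),
    Set.preimage_iInter₂, Finset.prod_congr rfl fun i hi ↦ Measure.map_apply hΦ (hX i (hB i hi))]
  exact h S hB

end Transfer

/-! ### Match events across the sequence of graphs, and the main theorem. -/

theorem edgeMatch_eq_indicator {Ω V E : Type*} {l : ℕ} (G : Graph V E) (M : V → Ω → Fin l) (k : E)
    (ω : Ω) : edgeMatch G M k ω = (matchSet G M k).indicator 1 ω := by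
  classical
  by_cases h : ω ∈ matchSet G M k
  · rw [Set.indicator_of_mem h]
    exact if_pos h
  · rw [Set.indicator_of_notMem h]
    exact if_neg h

/-- Compatibility gives an edge the same endpoints in every graph containing it, and graphs without
the edge contribute the empty set. The union is thus one event per edge, valid for all `m` at once.
-/
theorem iUnion_matchSet_eq {Ω V E : Type*} {l : ℕ} {G : ℕ → Graph V E}
    (hcompat : ∀ m n, (G m).Compatible (G n)) (M : V → Ω → Fin l) {m : ℕ} {k : E}
    (hk : k ∈ E(G m)) : ⋃ n, matchSet (G n) M k = matchSet (G m) M k := by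
  refine Set.Subset.antisymm (Set.iUnion_subset fun n ↦ ?_) (Set.subset_iUnion_of_subset m le_rfl)
  rintro ω ⟨i, j, h, hω⟩
  exact ⟨i, j, h.of_compatible (hcompat n m) hk, hω⟩

theorem corollary1
    {ΩW : Type*} [MeasurableSpace ΩW] (PW : Measure ΩW) [IsProbabilityMeasure PW]
    (W : ΩW → ℝ) (hW : MemLp W 2 PW) (μ σ : ℝ) (hμ : ∫ ω, W ω ∂PW = μ)
    (hσ : 0 < σ) (hvar : variance W PW = σ ^ 2)
    {V E : Type*} (G : ℕ → Graph V E) (hfin : ∀ m, E(G m).Finite)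
    (hcompat : ∀ m n, (G m).Compatible (G n))
    (hn : Tendsto (fun m => E(G m).ncard) atTop atTop)
    (K : ℕ) (hK : 2 ≤ K) (hgirth : ∀ m, ((K + 1 : ℕ) : ℕ∞) ≤ graphGirth (G m))
    (l : ℕ) (hl : 2 ≤ l)
    {Ω' : Type*} [MeasurableSpace Ω'] (P' : Measure Ω') [IsProbabilityMeasure P']
    (M : V → Ω' → Fin l)
    (hMmeas : ∀ i ∈ ⋃ m, V(G m), Measurable (M i))
    (hMunif : ∀ i ∈ ⋃ m, V(G m), ∀ c : Fin l, P' {ω | M i ω = c} = (l : ENNReal)⁻¹)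
    (hMindep : iIndepFun (fun i : ↥(⋃ m, V(G m)) => M i) P')
    (ν : Measure ℝ) [IsProbabilityMeasure ν]
    (hξ : TendstoInDistribution (fun m => xiStar (G m) M) atTop id (fun _ => P') ν)
    (hν : ¬ IsNormalLaw ν) :
    ∃ (Ω : Type) (_ : MeasurableSpace Ω) (P : Measure Ω) (_ : IsProbabilityMeasure P)
      (X : E → Ω → ℝ),
      (∀ k ∈ ⋃ m, E(G m), Measurable (X k) ∧ IdentDistrib (X k) W P PW) ∧
      (∀ m, TuplewiseIndep K (fun k : ↥E(G m) => X k) P) ∧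
      ∃ (ρ : Measure ℝ) (_ : IsProbabilityMeasure ρ),
        TendstoInDistribution (fun m => stdRowSum (G m) X μ σ) atTop id (fun _ => P) ρ ∧
        ¬ IsNormalLaw ρ := by
  classical
  -- the labels, restricted to one graph
  have hV : ∀ m, V(G m) ⊆ ⋃ m, V(G m) := fun m ↦ Set.subset_iUnion (fun m ↦ V(G m)) m
  have hMm : ∀ m, ∀ i ∈ V(G m), Measurable (M i) := fun m i hi ↦ hMmeas i (hV m hi)
  have hMu : ∀ m, ∀ i ∈ V(G m), ∀ c : Fin l, P' {ω | M i ω = c} = (l : ENNReal)⁻¹ :=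
    fun m i hi ↦ hMunif i (hV m hi)
  have hMi : ∀ m, iIndepFun (fun i : V(G m) ↦ M i) P' := fun m ↦
    hMindep.precomp (g := Set.inclusion (hV m)) (Set.inclusion_injective (hV m))
  -- the match events
  set p : ℝ := (l : ℝ)⁻¹ with hp
  have hl' : (2 : ℝ) ≤ l := by exact_mod_cast hl
  have hp0 : 0 < p := inv_pos.2 (by linarith)
  have hp1 : p < 1 := inv_lt_one_of_one_lt₀ (by linarith)
  have hpl : (l : ENNReal)⁻¹ = ENNReal.ofReal p := by
    rw [hp, ENNReal.ofReal_inv_of_pos (by linarith), ENNReal.ofReal_natCast]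
  let A : E → Set Ω' := fun k ↦ ⋃ m, matchSet (G m) M k
  have hAeq : ∀ m, ∀ k ∈ E(G m), A k = matchSet (G m) M k := fun m k hk ↦
    iUnion_matchSet_eq hcompat M hk
  have hA : ∀ m, ∀ k ∈ E(G m), MeasurableSet (A k) := fun m k hk ↦ by
    rw [hAeq m k hk]
    exact measurableSet_matchSet (hMm m) hk
  have hPA : ∀ m, ∀ k ∈ E(G m), P' (A k) = ENNReal.ofReal p := fun m k hk ↦ by
    rw [hAeq m k hk, ← hpl]
    simpa using measure_biInter_matchSet (hMm m) (hMu m) (hMi m) (hgirth m) {k}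
      (by simpa using hk) (by simp only [Finset.card_singleton]; omega)
  have hAind : ∀ m (ι : Type) [Fintype ι] (t : ι → E), Fintype.card ι ≤ K →
      Function.Injective t → (∀ j, t j ∈ E(G m)) → iIndepSet (fun j ↦ A (t j)) P' := by
    intro m ι _ t hι ht htG
    have h := iIndepSet_matchSet (hMm m) (hMu m) (hMi m) (by omega : 1 ≤ K) (hgirth m) hι t ht htG
    convert h using 2 with j
    exact hAeq m (t j) (htG j)
  let s : ℕ → Finset E := fun m ↦ (hfin m).toFinset
  have hmem : ∀ m k, k ∈ s m ↔ k ∈ E(G m) := fun m k ↦ (hfin m).mem_toFinset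
  have hncard : ∀ m, E(G m).ncard = (s m).card := fun m ↦ Set.ncard_eq_toFinset_card _ (hfin m)
  have hs : Tendsto (fun m ↦ (s m).card) atTop atTop := by simpa only [hncard] using hn
  have hpair : ∀ m, (s m : Set E).Pairwise fun i j ↦
      IndepFun ((A i).indicator (1 : Ω' → ℝ)) ((A j).indicator (1 : Ω' → ℝ)) P' := by
    intro m i hi j hj hij
    have hi' := (hmem m i).1 hi
    have hj' := (hmem m j).1 hj
    -- Pairwise independence is where `2 ≤ K` enters.
    have h := hAind m (Fin 2) ![i, j] (by simpa using hK)
      (by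
        intro a b hab
        fin_cases a <;> fin_cases b <;> simp_all)
      (by
        intro a
        fin_cases a
        exacts [hi', hj'])
    exact (h.iIndepFun_indicator (β := ℝ)).indepFun (i := 0) (j := 1) (by decide)
  -- the mixture
  have hWm : AEMeasurable W PW := hW.aestronglyMeasurable.aemeasurable
  have : IsProbabilityMeasure (PW.map W) := Measure.isProbabilityMeasure_map hWm
  obtain ⟨c, η₁, η₀, hc, hη₁, hη₀, h12, h02, h1, h0, hmix⟩ :=
    exists_centered_mixture (L := PW.map W) (μ := μ) (p := p)
      ((memLp_map_measure_iff aestronglyMeasurable_id hWm).2 hW)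
      ((integral_map hWm aestronglyMeasurable_id).trans hμ)
      (by rw [variance_id_map hWm, hvar]; positivity) hp0.le hp1.le
  let Q := P'.prod (Measure.infinitePi fun _ : E ↦ η₁.prod η₀)
  let Y : E → Ω' × (E → ℝ × ℝ) → ℝ := mixVar A μ c p
  have hYm : ∀ m, ∀ k ∈ E(G m), Measurable (Y k) := fun m k hk ↦ measurable_mixVar (hA m k hk)
  -- a copy of the variables on `ℕ → ℝ`
  have hcount : (⋃ m, E(G m)).Countable := Set.countable_iUnion fun m ↦ (hfin m).countable
  obtain ⟨f, hf⟩ := Set.countable_iff_exists_injOn.1 hcount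
  -- The probability space must lie in `Type`, while `Ω'` and `E` may live in any universe. The
  -- edges are countable, so all variables are recorded in one real sequence, with `0` at indices
  -- that code no edge.
  let Φ : Ω' × (E → ℝ × ℝ) → ℕ → ℝ := fun z n ↦
    if h : ∃ k, k ∈ (⋃ m, E(G m)) ∧ f k = n then Y h.choose z else 0
  have hΦY : ∀ m, ∀ k ∈ E(G m), ∀ z, Φ z (f k) = Y k z := by
    intro m k hk z
    have hk' : k ∈ ⋃ m, E(G m) := Set.mem_iUnion_of_mem m hk
    have h : ∃ k', k' ∈ (⋃ m, E(G m)) ∧ f k' = f k := ⟨k, hk', rfl⟩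
    simp only [Φ]
    rw [dif_pos h, hf h.choose_spec.1 hk' h.choose_spec.2]
  have hΦm : Measurable Φ := by
    refine measurable_pi_lambda _ fun n ↦ ?_
    by_cases h : ∃ k, k ∈ (⋃ m, E(G m)) ∧ f k = n
    · simp only [Φ, dif_pos h]
      obtain ⟨m, hm⟩ := Set.mem_iUnion.1 h.choose_spec.1
      exact hYm m _ hm
    · simp only [Φ, dif_neg h]
      exact measurable_const
  let X : E → (ℕ → ℝ) → ℝ := fun k x ↦ x (f k)
  have hXm : ∀ k, Measurable (X k) := fun k ↦ measurable_pi_apply _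
  have hXY : ∀ m, ∀ k ∈ E(G m), X k ∘ Φ = Y k := fun m k hk ↦ funext fun z ↦ hΦY m k hk z
  have hPprob : IsProbabilityMeasure (Q.map Φ) := Measure.isProbabilityMeasure_map hΦm.aemeasurable
  -- the limit law
  set r : ℝ := c * √(p * (1 - p)) / σ with hr
  have hq : 0 < p * (1 - p) := mul_pos hp0 (by linarith)
  have hr0 : r ≠ 0 := div_ne_zero (mul_ne_zero hc (Real.sqrt_pos.2 hq).ne') hσ.ne'
  -- The limiting variance of the noise sum: the second moments of `η₁` and `η₀` averaged with
  -- weights `p` and `1 - p`, over `σ ^ 2`.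
  let w : NNReal := ⟨(p * (∫ x, x ^ 2 ∂η₁) + (1 - p) * ∫ x, x ^ 2 ∂η₀) / σ ^ 2, by
    have e1 : 0 ≤ ∫ x, x ^ 2 ∂η₁ := integral_nonneg fun x ↦ sq_nonneg x
    have e0 : 0 ≤ ∫ x, x ^ 2 ∂η₀ := integral_nonneg fun x ↦ sq_nonneg x
    have : 0 ≤ 1 - p := by linarith
    positivity⟩
  have hνr : IsProbabilityMeasure (ν.map (r * ·)) :=
    Measure.isProbabilityMeasure_map (by fun_prop)
  have hSm : ∀ m, Measurable (stdRowSum (G m) X μ σ) := by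
    intro m
    unfold stdRowSum
    simp_rw [finsum_mem_eq_finite_toFinset_sum _ (hfin m)]
    exact ((Finset.measurable_fun_sum _ fun k _ ↦ hXm k).sub_const _).div_const _
  refine ⟨ℕ → ℝ, inferInstance, Q.map Φ, hPprob, X, ?_, ?_, (ν.map (r * ·)) ∗ gaussianReal 0 w,
    inferInstance, ?_, fun h ↦ hν (h.of_conv_gaussianReal hr0)⟩
  · intro k hk
    obtain ⟨m, hm⟩ := Set.mem_iUnion.1 hk
    refine ⟨hXm k, (hXm k).aemeasurable, hWm, ?_⟩
    rw [Measure.map_map (hXm k) hΦm, hXY m k hm, ← hmix]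
    exact map_mixVar (hA m k hm) hp0.le (hPA m k hm)
  · intro m t ht
    refine iIndepFun_map_of_comp hΦm (fun j ↦ hXm _) ?_
    have ht' : Function.Injective fun j ↦ (t j : E) := Subtype.val_injective.comp ht
    have h := iIndepFun_mixVar (μ := μ) (c := c) (p := p) (η₁ := η₁) (η₀ := η₀) ht'
      (fun j ↦ hA m _ (t j).2)
      (hAind m (Fin K) (fun j ↦ (t j : E)) (by simp) ht' fun j ↦ (t j).2)
    convert h using 2 with j
    exact hXY m _ (t j).2
  · refine ⟨fun m ↦ (hSm m).aemeasurable, aemeasurable_id, ?_⟩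
    refine ProbabilityMeasure.tendsto_iff_tendsto_charFun.2 fun t ↦ ?_
    have hξt := ProbabilityMeasure.tendsto_iff_tendsto_charFun.1 hξ.tendsto (r * t)
    simp only [ProbabilityMeasure.coe_mk, Measure.map_id] at hξt ⊢
    have hxi : ∀ m, xiStar (G m) M = fun ω ↦ ((∑ k ∈ s m, (A k).indicator 1 ω) -
        ((s m).card : ℝ) * p) / √(((s m).card : ℝ) * p * (1 - p)) := by
      intro m
      ext ω
      unfold xiStar
      rw [finsum_mem_eq_finite_toFinset_sum _ (hfin m), hncard]
      congr 2
      refine Finset.sum_congr rfl fun k hk ↦ ?_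
      rw [edgeMatch_eq_indicator, hAeq m k ((hmem m k).1 hk)]
    simp_rw [hxi] at hξt
    have hlim := tendsto_charFun_sum_mixVar (η₁ := η₁) (η₀ := η₀) (μ := μ) (c := c) hσ hp0 hp1
      h12 h02 h1 h0 hs (fun m k hk ↦ hA m k ((hmem m k).1 hk))
      (fun m k hk ↦ hPA m k ((hmem m k).1 hk)) hpair hξt
    rw [charFun_conv, charFun_map_mul, charFun_gaussianReal]
    convert hlim using 3 with m
    · rw [Measure.map_map (hSm m) hΦm]
      congr 1
      ext z
      simp only [Function.comp_apply, stdRowSum]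
      rw [finsum_mem_eq_finite_toFinset_sum _ (hfin m), hncard]
      congr 2
      exact Finset.sum_congr rfl fun k hk ↦ hΦY m k ((hmem m k).1 hk) z
    · have hw : ((w : ℝ) : ℂ) = ((p * (∫ x, x ^ 2 ∂η₁) + (1 - p) * ∫ x, x ^ 2 ∂η₀) / σ ^ 2 : ℝ) :=
        rfl
      rw [hw]
      push_cast
      congr 1
      field_simp
      ring
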